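/- Let $p$ be a prime, and let $v_p$ be the $p$-adic valuation on $\mathbf C_p$, normalized by $v_p(p)=1$ and with $v_p(0)=+\infty$. For a nonzero power series $F=\sum_{i\ge 0}F_iX^i\in\mathbf C_p[[X]]$ define its characteristic sequence $k_0<k_1<\cdots$ as follows: $k_0$ is the smallest index with $F_{k_0}\neq 0$ (so $k_0=0$ if $F(0)\ne 0$); given $k_{m-1}$, let $k_m$ be the largest integer $n>k_{m-1}$ at which $$l_m(n)=\frac{v_p(F_{k_{m-1}})-v_p(F_n)}{n-k_{m-1}}$$ attains its maximum over all integers $n>k_{m-1}$; if there is no such largest integer, the sequence ends with $k_{m-1}$. The valuation sequence of $F$ is $\alpha_m=\dfrac{v_p(F_{k_{m-1}})-v_p(F_{k_m})}{k_m-k_{m-1}}$ for those $m\ge 1$ for which $k_m$ exists; it is finite (possibly empty) or infinite. The valuation sequence of $F=0$ is empty. Proposition 5.2. Let $D$ be the open unit disc $\{x\in\mathbf C_p: v_p(x)>0\}$ or the closed unit disc $\{x\in\mathbf C_p: v_p(x)\ge 0\}$. Let $F,G\in\mathbf C_p[[X]]$ converge at every point of $D$ and have no common root in $D$, and let $(\alpha_m)$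 and $(\beta_m)$ be their valuation sequences. If the set $\{\alpha_1,\alpha_2,\dots\}\cap\{\beta_1,\beta_2,\dots\}$ is finite, then $$S=\sup_{x\in D}\min\bigl(v_p(F(x)),v_p(G(x))\bigr)<+\infty .$$ -/

import Mathlib

noncomputable section

namespace PadicSeries

variable {p : ℕ} [Fact p.Prime]

open Classical in
/-- The `p`-adic valuation on `ℂ_[p]`, normalized by `v_p(p) = 1`, with `v_p(0) = +∞`. -/
def vp (x : ℂ_[p]) : EReal :=
  if x = 0 then ⊤ else ((-Real.logb (p : ℝ) ‖x‖ : ℝ) : EReal)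

/-- `F` converges at every point of `D`. -/
def ConvergesOn (F : PowerSeries ℂ_[p]) (D : Set ℂ_[p]) : Prop :=
  ∀ x ∈ D, Summable fun i : ℕ => PowerSeries.coeff i F * x ^ i

/-- The value `F(x) = ∑ F_i x^i` (meaningful where the series converges). -/
def eval (F : PowerSeries ℂ_[p]) (x : ℂ_[p]) : ℂ_[p] :=
  ∑' i : ℕ, PowerSeries.coeff i F * x ^ i

/-- The function `l(n) = (v_p(F_k) - v_p(F_n)) / (n - k)`, used for `n > k`. If `F_k ≠ 0`, then
`l(n) = -∞` whenever `F_n = 0`. -/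
def rootSlope (F : PowerSeries ℂ_[p]) (k n : ℕ) : EReal :=
  (vp (PowerSeries.coeff k F) - vp (PowerSeries.coeff n F)) / (((n : ℝ) - (k : ℝ) : ℝ) : EReal)

/-- The integers `n > k` at which `l` attains its maximum over all integers greater than `k`. -/
def maximizers (F : PowerSeries ℂ_[p]) (k : ℕ) : Set ℕ :=
  {n | k < n ∧ ∀ j, k < j → rootSlope F k j ≤ rootSlope F k n}

open Classical in
/-- The largest integer at which `l` attains its maximum; `none` if there is no such integer. -/
def nextIndex (F : PowerSeries ℂ_[p]) (k : ℕ) : Option ℕ :=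
  if h : ∃ n, IsGreatest (maximizers F k) n then some h.choose else none

/-- The characteristic sequence `k_0, k_1, …` of `F`; it is `none` from the step on at which the
algorithm has ended. It starts at the first index with a nonzero coefficient, hence at `k_0 = 0`
when `F(0) ≠ 0`. For `F = 0` it consists of `k_0 = 0` only. -/
def charSeq (F : PowerSeries ℂ_[p]) : ℕ → Option ℕ
  | 0 => some F.order.toNat
  | m + 1 => (charSeq F m).bind (nextIndex F)

/-- The set of the terms `α_m = (v_p(F_{k_{m-1}}) - v_p(F_{k_m})) / (k_m - k_{m-1})`, `m ≥ 1`, of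
the sequence of `p`-adic valuations of the roots of `F`. -/
def rootValuations (F : PowerSeries ℂ_[p]) : Set EReal :=
  {a | ∃ m k k' : ℕ, charSeq F m = some k ∧ charSeq F (m + 1) = some k' ∧ a = rootSlope F k k'}

/-- `φ(x) = min (v_p(F(x)), v_p(G(x)))`. -/
def phi (F G : PowerSeries ℂ_[p]) (x : ℂ_[p]) : EReal :=
  min (vp (eval F x)) (vp (eval G x))

/-- The supremum `S` of `φ` over `D`, in the extended reals. -/
def supPhi (F G : PowerSeries ℂ_[p]) (D : Set ℂ_[p]) : EReal :=
  ⨆ x ∈ D, phi F G x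

end PadicSeries

end

/-! On a closed disc of radius `r` the norm of `F(x)` is a constant times the product of the
distances from `x` to finitely many roots of `F`: this is clear for the truncations of `F`, which
eventually all have the same number of roots in the disc, and the roots of the truncations
accumulate at roots of `F`. If `F` and `G` have no common root, their roots in the disc are
separated, so by the ultrametric inequality every `x` is far from the roots of one of them, and
there the product is bounded below.

Near the boundary of the open unit disc, `v_p(x)` avoids the valuation sequence of `F` or that of
`G`, say of `F`. Two terms `F_i x^i` of maximal norm would make `v_p(x)` a slope of the Newton
polygon of `F`, so there is a single one, and `‖F(x)‖` is at least the norm of each term. -/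

open Filter Topology

namespace PadicSeries

section Ultrametric

variable {K : Type*} [NormedField K]

/-- `N` is the Weierstrass degree of `F` on the closed disc of radius `r`: the last index at which
`‖F_i‖ * r ^ i` is maximal. -/
structure IsWeierstrassDegree (F : PowerSeries K) (r : ℝ) (N : ℕ) : Prop where
  le : ∀ i, ‖F.coeff i‖ * r ^ i ≤ ‖F.coeff N‖ * r ^ N
  lt : ∀ i, N < i → ‖F.coeff i‖ * r ^ i < ‖F.coeff N‖ * r ^ N

namespace IsWeierstrassDegree

variable {F G : PowerSeries K} {r : ℝ} {M N : ℕ}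

lemma term_pos (h : IsWeierstrassDegree F r N) (hr : 0 < r) : 0 < ‖F.coeff N‖ * r ^ N :=
  lt_of_le_of_lt (by positivity) (h.lt (N + 1) N.lt_succ_self)

lemma norm_coeff_pos (h : IsWeierstrassDegree F r N) (hr : 0 < r) : 0 < ‖F.coeff N‖ :=
  pos_of_mul_pos_left (h.term_pos hr) (by positivity)

lemma unique (hM : IsWeierstrassDegree F r M) (hN : IsWeierstrassDegree F r N) : M = N :=
  le_antisymm (not_lt.1 fun h => (hN.lt M h).not_ge (hM.le N))
    (not_lt.1 fun h => (hM.lt N h).not_ge (hN.le M))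

lemma norm_mul_term_lt (hF : IsWeierstrassDegree F r M) (hG : IsWeierstrassDegree G r N)
    (hr : 0 < r) {i j : ℕ} (hij : M < i ∨ N < j) :
    ‖F.coeff i * G.coeff j‖ * r ^ (i + j) < ‖F.coeff M * G.coeff N‖ * r ^ (M + N) := by
  simp only [norm_mul, pow_add, mul_mul_mul_comm _ _ (r ^ _)]
  rcases hij with hi | hj
  · exact mul_lt_mul_of_lt_of_le_of_nonneg_of_pos (hF.lt i hi) (hG.le j) (by positivity)
      (hG.term_pos hr)
  · exact mul_lt_mul_of_le_of_lt_of_nonneg_of_pos (hF.le i) (hG.lt j hj) (by positivity)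
      (hF.term_pos hr)

lemma norm_mul_term_le (hF : IsWeierstrassDegree F r M) (hG : IsWeierstrassDegree G r N)
    (hr : 0 < r) (i j : ℕ) :
    ‖F.coeff i * G.coeff j‖ * r ^ (i + j) ≤ ‖F.coeff M * G.coeff N‖ * r ^ (M + N) := by
  simp only [norm_mul, pow_add, mul_mul_mul_comm _ _ (r ^ _)]
  gcongr ?_ * ?_
  exacts [hF.le i, hG.le j]

variable [IsUltrametricDist K]

lemma norm_coeff_mul (hF : IsWeierstrassDegree F r M) (hG : IsWeierstrassDegree G r N)
    (hr : 0 < r) : ‖(F * G).coeff (M + N)‖ = ‖F.coeff M‖ * ‖G.coeff N‖ := by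
  rw [PowerSeries.coeff_mul, ← norm_mul]
  refine IsUltrametricDist.isNonarchimedean_norm.apply_sum_eq_of_lt
    (f := fun x : K => ‖x‖) (fun a => (norm_neg a).symm) (k := (M, N)) (by simp) ?_
  rintro ⟨i, j⟩ hij hne
  rw [Finset.HasAntidiagonal.mem_antidiagonal] at hij
  have hlt := hF.norm_mul_term_lt hG hr (i := i) (j := j) (by grind)
  rw [hij] at hlt
  exact lt_of_mul_lt_mul_right hlt (by positivity)

protected lemma mul (hF : IsWeierstrassDegree F r M) (hG : IsWeierstrassDegree G r N)
    (hr : 0 < r) : IsWeierstrassDegree (F * G) r (M + N) := by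
  have exists_term (k : ℕ) : ∃ i j, i + j = k ∧
      ‖(F * G).coeff k‖ * r ^ k ≤ ‖F.coeff i * G.coeff j‖ * r ^ (i + j) := by
    obtain ⟨⟨i, j⟩, hij, hle⟩ := IsUltrametricDist.exists_norm_finsetSum_le_of_nonempty
      ⟨(0, k), Finset.HasAntidiagonal.mem_antidiagonal.2 (zero_add k)⟩
      fun ij : ℕ × ℕ => F.coeff ij.1 * G.coeff ij.2
    rw [Finset.HasAntidiagonal.mem_antidiagonal] at hij
    refine ⟨i, j, hij, ?_⟩
    rw [PowerSeries.coeff_mul, hij]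
    gcongr
  constructor <;> intro k <;> rw [hF.norm_coeff_mul hG hr, ← norm_mul] <;>
    obtain ⟨i, j, hij, hle⟩ := exists_term k
  · exact hle.trans (hF.norm_mul_term_le hG hr i j)
  · exact fun hk => hle.trans_lt (hF.norm_mul_term_lt hG hr (by omega))

end IsWeierstrassDegree

lemma isWeierstrassDegree_X_sub_C_of_norm_le {ξ : K} {r : ℝ} (hr : 0 < r) (hξ : ‖ξ‖ ≤ r) :
    IsWeierstrassDegree (PowerSeries.X - PowerSeries.C ξ) r 1 := by
  constructor <;> rintro (_ | _ | i) <;> simp [PowerSeries.coeff_X, hξ, hr, hr.le]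

lemma isWeierstrassDegree_X_sub_C_of_lt_norm {ξ : K} {r : ℝ} (hr : 0 < r) (hξ : r < ‖ξ‖) :
    IsWeierstrassDegree (PowerSeries.X - PowerSeries.C ξ) r 0 := by
  constructor <;> rintro (_ | _ | i) <;> simp [PowerSeries.coeff_X, hξ.le, hξ, hr.trans hξ]

lemma isWeierstrassDegree_C {a : K} (ha : a ≠ 0) (r : ℝ) :
    IsWeierstrassDegree (PowerSeries.C a) r 0 := by
  constructor <;> rintro (_ | i) <;> simp [PowerSeries.coeff_C, ha]

lemma norm_term_le_of_norm_le (a : K) {x : K} {r : ℝ} (hx : ‖x‖ ≤ r) (i : ℕ) :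
    ‖a * x ^ i‖ ≤ ‖a‖ * r ^ i := by
  rw [norm_mul, norm_pow]
  gcongr

lemma IsWeierstrassDegree.trunc {F : PowerSeries K} {r : ℝ} {N n : ℕ}
    (h : IsWeierstrassDegree F r N) (hr : 0 < r) (hn : N < n) :
    IsWeierstrassDegree (F.trunc n : PowerSeries K) r N := by
  constructor <;> intro i <;>
    simp only [Polynomial.coeff_coe, PowerSeries.coeff_trunc, if_pos hn] <;> split_ifs
  · exact h.le i
  · simpa using (h.term_pos hr).le
  · exact h.lt i
  · simpa using fun _ => h.term_pos hr

variable [IsUltrametricDist K]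

lemma norm_sub_eq_of_norm_lt {x ξ : K} (h : ‖x‖ < ‖ξ‖) : ‖x - ξ‖ = ‖ξ‖ := by
  rw [sub_eq_add_neg, IsUltrametricDist.norm_add_eq_max_of_norm_ne_norm (by simpa using h.ne),
    norm_neg, max_eq_right h.le]

lemma exists_roots_C_mul_prod_X_sub_C {a : K} (ha : a ≠ 0) (s : Multiset K) {r : ℝ} (hr : 0 < r) :
    letI g : Polynomial K :=
      Polynomial.C a * (s.map fun ξ => Polynomial.X - Polynomial.C ξ).prod
    ∃ (N : ℕ) (ξ : Fin N → K), IsWeierstrassDegree (g : PowerSeries K) r N ∧ (∀ i, ‖ξ i‖ ≤ r) ∧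
      ∀ x, ‖x‖ ≤ r → ‖g.eval x‖ = ‖g.coeff N‖ * ∏ i, ‖x - ξ i‖ := by
  induction s using Multiset.induction with
  | empty => exact ⟨0, ![], by simpa using isWeierstrassDegree_C ha r, by simp⟩
  | cons ξ₀ s ih =>
    obtain ⟨N, ξ, hdeg, hξ, heval⟩ := ih
    rw [Multiset.map_cons, Multiset.prod_cons, mul_comm (Polynomial.X - _), ← mul_assoc]
    generalize Polynomial.C a * (s.map fun ξ => Polynomial.X - Polynomial.C ξ).prod = g at *
    simp only [Polynomial.eval_mul, norm_mul, Polynomial.eval_sub, Polynomial.eval_X,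
      Polynomial.eval_C, ← Polynomial.coeff_coe, Polynomial.coe_mul, Polynomial.coe_sub,
      Polynomial.coe_X, Polynomial.coe_C] at heval ⊢
    rcases le_or_gt ‖ξ₀‖ r with hξ₀ | hξ₀
    · have hlin := isWeierstrassDegree_X_sub_C_of_norm_le hr hξ₀
      refine ⟨N + 1, Fin.cons ξ₀ ξ, hdeg.mul hlin hr, Fin.cases hξ₀ hξ, fun x hx => ?_⟩
      have hcoeff := hdeg.norm_coeff_mul hlin hr
      rw [map_sub, PowerSeries.coeff_one_X, PowerSeries.coeff_C, if_neg one_ne_zero, sub_zero,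
        norm_one, mul_one] at hcoeff
      rw [hcoeff, heval x hx, Fin.prod_univ_succ, Fin.cons_zero, mul_assoc, mul_comm ‖x - ξ₀‖]
      simp only [Fin.cons_succ]
    · have hlin := isWeierstrassDegree_X_sub_C_of_lt_norm hr hξ₀
      refine ⟨N, ξ, hdeg.mul hlin hr, hξ, fun x hx => ?_⟩
      have hcoeff := hdeg.norm_coeff_mul hlin hr
      rw [add_zero] at hcoeff
      rw [hcoeff, heval x hx, norm_sub_eq_of_norm_lt (hx.trans_lt hξ₀), mul_right_comm]
      simp

lemma IsWeierstrassDegree.exists_roots_of_polynomial [IsAlgClosed K] {g : Polynomial K} {r : ℝ}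
    {N : ℕ} (hr : 0 < r) (hg : IsWeierstrassDegree (g : PowerSeries K) r N) :
    ∃ ξ : Fin N → K, (∀ i, ‖ξ i‖ ≤ r) ∧
      ∀ x, ‖x‖ ≤ r → ‖g.eval x‖ = ‖g.coeff N‖ * ∏ i, ‖x - ξ i‖ := by
  have hlead : g.leadingCoeff ≠ 0 := by
    intro h0
    simpa [Polynomial.leadingCoeff_eq_zero.1 h0] using hg.norm_coeff_pos hr
  obtain ⟨s, hs⟩ := Polynomial.splits_iff_exists_multiset.1 (IsAlgClosed.splits g)
  obtain ⟨M, ξ, hM, hξ⟩ := exists_roots_C_mul_prod_X_sub_C hlead s hr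
  rw [← hs] at hM hξ
  obtain rfl := hM.unique hg
  exact ⟨ξ, hξ⟩

lemma norm_eval_trunc_sub_eval_trunc_le {F : PowerSeries K} {r ε : ℝ} {m n : ℕ} (hε : 0 ≤ ε)
    (hF : ∀ i, m ≤ i → ‖F.coeff i‖ * r ^ i ≤ ε) (hmn : m ≤ n) {x : K} (hx : ‖x‖ ≤ r) :
    ‖(F.trunc m).eval x - (F.trunc n).eval x‖ ≤ ε := by
  rw [norm_sub_rev]
  simp only [Polynomial.eval, PowerSeries.eval₂_trunc_eq_sum_range, RingHom.id_apply]
  rw [← Finset.sum_Ico_eq_sub _ hmn]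
  exact IsUltrametricDist.norm_sum_le_of_forall_le_of_nonneg hε fun i hi =>
    (norm_term_le_of_norm_le _ hx i).trans (hF i (Finset.mem_Ico.1 hi).1)

lemma pow_le_prod_of_forall_le {N : ℕ} {d : Fin N → ℝ} {δ : ℝ} (hδ : 0 ≤ δ) (h : ∀ i, δ ≤ d i) :
    δ ^ N ≤ ∏ i, d i := by
  simpa using Finset.prod_le_prod (s := Finset.univ) (fun _ _ => hδ) fun i _ => h i

lemma exists_tendsto_of_eventually_exists_dist_lt {X ι : Type*} [PseudoMetricSpace X]
    [CompleteSpace X] {U : Ultrafilter ι} {ξ : ι → X}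
    (h : ∀ δ > 0, ∃ s : Set X, s.Finite ∧ ∀ᶠ n in U, ∃ a ∈ s, dist (ξ n) a < δ) :
    ∃ a, Tendsto ξ U (𝓝 a) := by
  refine cauchy_map_iff_exists_tendsto.1 (Metric.cauchy_iff.2 ⟨inferInstance, fun δ hδ => ?_⟩)
  obtain ⟨s, hs, hev⟩ := h (δ / 2) (half_pos hδ)
  obtain ⟨a, -, ha⟩ := (Ultrafilter.eventually_exists_mem_iff hs).1 hev
  exact ⟨Metric.ball a (δ / 2), ha, fun y hy z hz =>
    (dist_triangle_right y z a).trans_lt (by linarith [Metric.mem_ball.1 hy, Metric.mem_ball.1 hz])⟩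

lemma hasSum_of_isRestricted [CompleteSpace K] {F : PowerSeries K} {r : ℝ}
    (hF : F.IsRestricted r) {x : K} (hx : ‖x‖ ≤ r) :
    HasSum (fun i => F.coeff i * x ^ i) (∑' i, F.coeff i * x ^ i) := by
  refine (NonarchimedeanAddGroup.summable_of_tendsto_cofinite_zero ?_).hasSum
  exact squeeze_zero_norm (fun i => norm_term_le_of_norm_le _ hx i)
    ((PowerSeries.isRestricted_iff r F).1 hF)

lemma tendsto_eval_trunc [CompleteSpace K] {F : PowerSeries K} {r : ℝ}
    (hF : F.IsRestricted r) {x : K} (hx : ‖x‖ ≤ r) :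
    Tendsto (fun n => (F.trunc n).eval x) atTop (𝓝 (∑' i, F.coeff i * x ^ i)) := by
  simpa only [Polynomial.eval, PowerSeries.eval₂_trunc_eq_sum_range, RingHom.id_apply]
    using (hasSum_of_isRestricted hF hx).tendsto_sum_nat

lemma IsWeierstrassDegree.exists_roots_trunc [IsAlgClosed K] {F : PowerSeries K} {r : ℝ} {N n : ℕ}
    (hr : 0 < r) (hN : IsWeierstrassDegree F r N) (hn : N < n) :
    ∃ ξ : Fin N → K, (∀ i, ‖ξ i‖ ≤ r) ∧
      ∀ x, ‖x‖ ≤ r → ‖(F.trunc n).eval x‖ = ‖F.coeff N‖ * ∏ i, ‖x - ξ i‖ := by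
  simpa only [PowerSeries.coeff_trunc, if_pos hn] using
    (hN.trunc hr hn).exists_roots_of_polynomial hr

lemma IsWeierstrassDegree.exists_forall_dist_roots_lt {F : PowerSeries K} {r : ℝ} {N : ℕ}
    (hr : 0 < r) (hF : F.IsRestricted r) (hN : IsWeierstrassDegree F r N) {ξ : ℕ → Fin N → K}
    (hξ : ∀ n i, ‖ξ n i‖ ≤ r)
    (heval : ∀ n x, ‖x‖ ≤ r →
      ‖(F.trunc (n + (N + 1))).eval x‖ = ‖F.coeff N‖ * ∏ i, ‖x - ξ n i‖) {δ : ℝ} (hδ : 0 < δ) :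
    ∃ m, ∀ n ≥ m, ∀ i, ∃ j, dist (ξ n i) (ξ m j) < δ := by
  have hpos := hN.norm_coeff_pos hr
  obtain ⟨m, hm⟩ := eventually_atTop.1 <|
    ((PowerSeries.isRestricted_iff' r F).1 hF).eventually_le_const
      (show 0 < ‖F.coeff N‖ * δ ^ N / 2 by positivity)
  refine ⟨m, fun n hmn i => ?_⟩
  by_contra! hfar
  have hroot : (F.trunc (n + (N + 1))).eval (ξ n i) = 0 := by
    rw [← norm_eq_zero, heval n _ (hξ n i),
      Finset.prod_eq_zero (Finset.mem_univ i) (by rw [sub_self, norm_zero]), mul_zero]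
  -- The `m`-th truncation is small at a root of the `n`-th one, so one of its factors is small.
  have hsmall := norm_eval_trunc_sub_eval_trunc_le (m := m + (N + 1)) (n := n + (N + 1))
    (by positivity) (fun k hk => hm k (by omega)) (by omega) (hξ n i)
  rw [hroot, sub_zero, heval m _ (hξ n i)] at hsmall
  simp only [dist_eq_norm] at hfar
  have hlarge := mul_le_mul_of_nonneg_left (pow_le_prod_of_forall_le hδ.le hfar) hpos.le
  exact (half_lt_self (by positivity)).not_ge (hlarge.trans hsmall)

theorem IsWeierstrassDegree.exists_roots [CompleteSpace K] [IsAlgClosed K] {F : PowerSeries K}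
    {r : ℝ} {N : ℕ} (hr : 0 < r) (hF : F.IsRestricted r) (hN : IsWeierstrassDegree F r N) :
    ∃ ξ : Fin N → K, (∀ i, ‖ξ i‖ ≤ r) ∧
      ∀ x, ‖x‖ ≤ r → ‖∑' i, F.coeff i * x ^ i‖ = ‖F.coeff N‖ * ∏ i, ‖x - ξ i‖ := by
  choose ξ hξ heval using fun n => hN.exists_roots_trunc (n := n + (N + 1)) hr (by omega)
  have hU : (hyperfilter ℕ : Filter ℕ) ≤ atTop := Nat.hyperfilter_le_atTop
  -- The roots are numbered arbitrarily for each `n`; a limit along an ultrafilter avoids matching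
  -- the roots of consecutive truncations.
  have exists_limit (i : Fin N) : ∃ a, Tendsto (ξ · i) (hyperfilter ℕ) (𝓝 a) := by
    refine exists_tendsto_of_eventually_exists_dist_lt fun δ hδ => ?_
    obtain ⟨m, hm⟩ := hN.exists_forall_dist_roots_lt hr hF hξ heval hδ
    refine ⟨Set.range (ξ m), Set.finite_range _, hU ?_⟩
    filter_upwards [eventually_ge_atTop m] with n hn
    exact Set.exists_range_iff.2 (hm n hn i)
  choose a ha using exists_limit
  refine ⟨a, fun i => le_of_tendsto (ha i).norm (.of_forall fun n => hξ n i), fun x hx => ?_⟩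
  have hleft := ((tendsto_add_atTop_iff_nat (N + 1)).2 (tendsto_eval_trunc hF hx)).mono_left hU
  refine tendsto_nhds_unique hleft.norm ?_
  simp only [heval _ x hx]
  exact (tendsto_finsetProd _ fun i _ => ((ha i).const_sub x).norm).const_mul _

end Ultrametric

section Consequences

variable {K : Type*} [NormedField K]

lemma exists_last_max {s : Finset ℕ} (hs : s.Nonempty) {α : Type*} [LinearOrder α] (f : ℕ → α) :
    ∃ n ∈ s, (∀ i ∈ s, f i ≤ f n) ∧ ∀ i ∈ s, n < i → f i < f n := by
  obtain ⟨n, hn, hmax⟩ := s.exists_max_image (fun i => toLex (f i, i)) hs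
  simp only [Prod.Lex.toLex_le_toLex] at hmax
  exact ⟨n, hn, fun i hi => (hmax i hi).elim le_of_lt fun h => h.1.le,
    fun i hi hni => (hmax i hi).resolve_right fun h => hni.not_ge h.2⟩

lemma exists_isWeierstrassDegree {F : PowerSeries K} (hF0 : F ≠ 0) {r : ℝ} (hr : 0 < r)
    (hF : F.IsRestricted r) : ∃ N, IsWeierstrassDegree F r N := by
  obtain ⟨k, hk⟩ := PowerSeries.exists_coeff_ne_zero_iff_ne_zero.2 hF0
  have hkpos : 0 < ‖F.coeff k‖ * r ^ k := by positivity
  have hfin : {i | ‖F.coeff k‖ * r ^ k ≤ ‖F.coeff i‖ * r ^ i}.Finite := by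
    simpa only [eventually_cofinite, not_lt] using
      ((PowerSeries.isRestricted_iff r F).1 hF).eventually_lt_const hkpos
  obtain ⟨N, hN, hle, hlt⟩ := exists_last_max (s := hfin.toFinset) ⟨k, by simp⟩
    fun i => ‖F.coeff i‖ * r ^ i
  simp only [Set.Finite.mem_toFinset, Set.mem_ofPred_eq] at hN hle hlt
  refine ⟨N, fun i => ?_, fun i hi => ?_⟩ <;>
    rcases le_or_gt (‖F.coeff k‖ * r ^ k) (‖F.coeff i‖ * r ^ i) with h | h
  exacts [hle i h, (h.trans_le hN).le, hlt i h hi, h.trans_le hN]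

variable [IsUltrametricDist K]

lemma norm_eq_of_hasSum_of_forall_lt {u : ℕ → K} {s : K} (hs : HasSum u s) {N : ℕ}
    (hN : ∀ i ≠ N, ‖u i‖ < ‖u N‖) : ‖s‖ = ‖u N‖ := by
  refine tendsto_nhds_unique hs.tendsto_sum_nat.norm (tendsto_const_nhds.congr' ?_)
  filter_upwards [eventually_gt_atTop N] with n hn
  exact (IsUltrametricDist.isNonarchimedean_norm.apply_sum_eq_of_lt (f := fun x : K => ‖x‖)
    (fun a => (norm_neg a).symm) (Finset.mem_range.2 hn) fun i _ hi => hN i hi).symm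

lemma exists_pos_forall_le_norm_sub {M N : ℕ} {ξ : Fin M → K} {η : Fin N → K}
    (h : ∀ i j, ξ i ≠ η j) :
    ∃ δ > 0, ∀ x, (∀ i, δ ≤ ‖x - ξ i‖) ∨ ∀ j, δ ≤ ‖x - η j‖ := by
  have hsmall : ∀ᶠ δ in 𝓝[>] (0 : ℝ), ∀ i j, δ < ‖ξ i - η j‖ :=
    eventually_all.2 fun i => eventually_all.2 fun j =>
      (eventually_lt_nhds (norm_sub_pos_iff.2 (h i j))).filter_mono nhdsWithin_le_nhds
  obtain ⟨δ, hδ, hpos⟩ := (hsmall.and self_mem_nhdsWithin).exists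
  refine ⟨δ, hpos, fun x => ?_⟩
  by_contra! ⟨⟨i, hi⟩, j, hj⟩
  refine (hδ i j).not_ge ?_
  rw [← dist_eq_norm] at hi hj ⊢
  exact (dist_triangle_max _ x _).trans (max_le (dist_comm x _ ▸ hi.le) hj.le)

variable [CompleteSpace K] [IsAlgClosed K] {F G : PowerSeries K} {r : ℝ}

lemma norm_tsum_eq_norm_coeff_zero (hr : 0 < r) (hF : F.IsRestricted r)
    (hroot : ∀ x, ‖x‖ ≤ r → ∑' i, F.coeff i * x ^ i ≠ 0) {x : K} (hx : ‖x‖ ≤ r) :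
    ‖∑' i, F.coeff i * x ^ i‖ = ‖F.coeff 0‖ := by
  have hF0 : F ≠ 0 := by
    rintro rfl
    exact hroot 0 (by simpa using hr.le) (by simp)
  obtain ⟨N, hN⟩ := exists_isWeierstrassDegree hF0 hr hF
  obtain ⟨ξ, hξ, heval⟩ := hN.exists_roots hr hF
  cases N with
  | zero => simpa using heval x hx
  | succ N =>
    refine absurd ?_ (hroot (ξ 0) (hξ 0))
    rw [← norm_eq_zero, heval _ (hξ 0), Fin.prod_univ_succ, sub_self, norm_zero, zero_mul,
      mul_zero]

theorem exists_pos_le_max_norm_tsum (hF0 : F ≠ 0) (hG0 : G ≠ 0) (hr : 0 < r)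
    (hF : F.IsRestricted r) (hG : G.IsRestricted r)
    (hroot : ∀ x, ‖x‖ ≤ r → ¬(∑' i, F.coeff i * x ^ i = 0 ∧ ∑' i, G.coeff i * x ^ i = 0)) :
    ∃ c > 0, ∀ x, ‖x‖ ≤ r → c ≤ max ‖∑' i, F.coeff i * x ^ i‖ ‖∑' i, G.coeff i * x ^ i‖ := by
  obtain ⟨M, hM⟩ := exists_isWeierstrassDegree hF0 hr hF
  obtain ⟨N, hN⟩ := exists_isWeierstrassDegree hG0 hr hG
  obtain ⟨ξ, hξ, hFξ⟩ := hM.exists_roots hr hF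
  obtain ⟨η, -, hGη⟩ := hN.exists_roots hr hG
  have hne (i : Fin M) (j : Fin N) : ξ i ≠ η j := by
    intro hij
    refine hroot (ξ i) (hξ i) ⟨?_, ?_⟩ <;> rw [← norm_eq_zero]
    · rw [hFξ _ (hξ i), Finset.prod_eq_zero (Finset.mem_univ i) (by simp), mul_zero]
    · rw [hGη _ (hξ i), Finset.prod_eq_zero (Finset.mem_univ j) (by simp [hij]), mul_zero]
  obtain ⟨δ, hδ, hsep⟩ := exists_pos_forall_le_norm_sub hne
  refine ⟨min (‖F.coeff M‖ * δ ^ M) (‖G.coeff N‖ * δ ^ N), ?_, fun x hx => ?_⟩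
  · have hFM := hM.norm_coeff_pos hr
    have hGN := hN.norm_coeff_pos hr
    positivity
  rw [hFξ x hx, hGη x hx]
  rcases hsep x with h | h
  · refine (min_le_left _ _).trans (le_max_of_le_left ?_)
    gcongr
    exact pow_le_prod_of_forall_le hδ.le h
  · refine (min_le_right _ _).trans (le_max_of_le_right ?_)
    gcongr
    exact pow_le_prod_of_forall_le hδ.le h

end Consequences

section Valuations

variable {p : ℕ} [Fact p.Prime] {F : PowerSeries ℂ_[p]} {r : ℝ} {k m n N : ℕ}

lemma one_lt_natCast_prime (p : ℕ) [Fact p.Prime] : (1 : ℝ) < p :=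
  Nat.one_lt_cast.2 (Fact.out : p.Prime).one_lt

lemma vp_of_ne_zero {x : ℂ_[p]} (hx : x ≠ 0) : vp x = ((-Real.logb p ‖x‖ : ℝ) : EReal) :=
  if_neg hx

lemma rootSlope_of_coeff_eq_zero (hkn : k < n) (hk : F.coeff k ≠ 0) (hn : F.coeff n = 0) :
    rootSlope F k n = ⊥ := by
  have hpos : (0 : EReal) < ((n - k : ℝ) : EReal) := by
    exact_mod_cast sub_pos.2 (Nat.cast_lt (α := ℝ).2 hkn)
  rw [rootSlope, vp_of_ne_zero hk, hn, vp, if_pos rfl, EReal.sub_top,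
    EReal.bot_div_of_pos_ne_top hpos (EReal.coe_ne_top _)]

lemma rootSlope_of_coeff_ne_zero (hk : F.coeff k ≠ 0) (hn : F.coeff n ≠ 0) :
    rootSlope F k n =
      (((Real.logb p ‖F.coeff n‖ - Real.logb p ‖F.coeff k‖) / (n - k) : ℝ) : EReal) := by
  rw [rootSlope, vp_of_ne_zero hk, vp_of_ne_zero hn, ← EReal.coe_sub, ← EReal.coe_div]
  congr 2
  ring

lemma logb_term {a : ℂ_[p]} (ha : a ≠ 0) (hr : 0 < r) (i : ℕ) :
    Real.logb p (‖a‖ * r ^ i) = Real.logb p ‖a‖ + i * Real.logb p r := by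
  rw [Real.logb_mul (norm_ne_zero_iff.2 ha) (by positivity), Real.logb_pow]

lemma rootSlope_le_neg_logb_iff (hr : 0 < r) (hkn : k < n) (hk : F.coeff k ≠ 0) :
    rootSlope F k n ≤ ((-Real.logb p r : ℝ) : EReal) ↔
      ‖F.coeff n‖ * r ^ n ≤ ‖F.coeff k‖ * r ^ k := by
  by_cases hn : F.coeff n = 0
  · simp only [rootSlope_of_coeff_eq_zero hkn hk hn, bot_le, hn, norm_zero, zero_mul, true_iff]
    positivity
  have hsub : (0 : ℝ) < n - k := sub_pos.2 (Nat.cast_lt.2 hkn)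
  rw [rootSlope_of_coeff_ne_zero hk hn, EReal.coe_le_coe_iff, div_le_iff₀ hsub,
    ← Real.logb_le_logb (x := ‖F.coeff n‖ * r ^ n) (one_lt_natCast_prime p) (by positivity)
      (by positivity), logb_term hn hr, logb_term hk hr]
  constructor <;> intro h <;> linarith

lemma neg_logb_le_rootSlope_iff (hr : 0 < r) (hkn : k < n) (hk : F.coeff k ≠ 0) :
    ((-Real.logb p r : ℝ) : EReal) ≤ rootSlope F k n ↔
      ‖F.coeff k‖ * r ^ k ≤ ‖F.coeff n‖ * r ^ n := by
  by_cases hn : F.coeff n = 0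
  · simp only [rootSlope_of_coeff_eq_zero hkn hk hn, le_bot_iff, EReal.coe_ne_bot, hn, norm_zero,
      zero_mul, false_iff, not_le]
    positivity
  have hsub : (0 : ℝ) < n - k := sub_pos.2 (Nat.cast_lt.2 hkn)
  rw [rootSlope_of_coeff_ne_zero hk hn, EReal.coe_le_coe_iff, le_div_iff₀ hsub,
    ← Real.logb_le_logb (x := ‖F.coeff k‖ * r ^ k) (one_lt_natCast_prime p) (by positivity)
      (by positivity), logb_term hn hr, logb_term hk hr]
  constructor <;> intro h <;> linarith

lemma exists_rootSlope_eq_neg_logb (hk : F.coeff k ≠ 0) (hn : F.coeff n ≠ 0) :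
    ∃ r : ℝ, 0 < r ∧ rootSlope F k n = ((-Real.logb p r : ℝ) : EReal) := by
  have hp := one_lt_natCast_prime p
  refine ⟨(p : ℝ) ^ (-((Real.logb p ‖F.coeff n‖ - Real.logb p ‖F.coeff k‖) / (n - k))),
    Real.rpow_pos_of_pos (by positivity) _, ?_⟩
  rw [Real.logb_rpow (by positivity) hp.ne', neg_neg, rootSlope_of_coeff_ne_zero hk hn]

lemma nextIndex_eq_some (h : IsGreatest (maximizers F k) n) : nextIndex F k = some n := by
  have hex : ∃ n, IsGreatest (maximizers F k) n := ⟨n, h⟩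
  rw [nextIndex, dif_pos hex, hex.choose_spec.unique h]

lemma rootSlope_lt_rootSlope (hr : 0 < r) (hkm : k < m) (hmn : m < n) (hk : F.coeff k ≠ 0)
    (hlt : ‖F.coeff k‖ * r ^ k < ‖F.coeff m‖ * r ^ m)
    (hle : ‖F.coeff n‖ * r ^ n ≤ ‖F.coeff m‖ * r ^ m) : rootSlope F k n < rootSlope F k m := by
  have hm : F.coeff m ≠ 0 := by
    intro h0
    rw [h0, norm_zero, zero_mul] at hlt
    exact hlt.not_ge (by positivity)
  -- On the circle of radius `t` the terms at `k` and `m` have equal norm.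
  obtain ⟨t, ht, hslope⟩ := exists_rootSlope_eq_neg_logb hk hm
  have hrt : ((-Real.logb p r : ℝ) : EReal) < rootSlope F k m := by
    rw [← not_le, rootSlope_le_neg_logb_iff hr hkm hk]
    exact hlt.not_ge
  have hmn_slope : rootSlope F m n < ((-Real.logb p t : ℝ) : EReal) :=
    hslope ▸ ((rootSlope_le_neg_logb_iff hr hmn hm).2 hle).trans_lt hrt
  rw [hslope, ← not_le, neg_logb_le_rootSlope_iff ht (hkm.trans hmn) hk, not_le]
  rw [← not_le, neg_logb_le_rootSlope_iff ht hmn hm, not_le] at hmn_slope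
  exact hmn_slope.trans_le ((rootSlope_le_neg_logb_iff ht hkm hk).1 hslope.le)

lemma exists_nextIndex_le (hr : 0 < r) (hkm : k < m) (hk : F.coeff k ≠ 0)
    (hlt : ‖F.coeff k‖ * r ^ k < ‖F.coeff m‖ * r ^ m)
    (hle : ∀ j, ‖F.coeff j‖ * r ^ j ≤ ‖F.coeff m‖ * r ^ m) :
    ∃ k', nextIndex F k = some k' ∧ k < k' ∧ k' ≤ m ∧ F.coeff k' ≠ 0 := by
  obtain ⟨k', hk', hmax, hlast⟩ := exists_last_max (Finset.nonempty_Ioc.2 hkm) (rootSlope F k)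
  simp only [Finset.mem_Ioc] at hk' hmax hlast
  have hkm' := hmax m ⟨hkm, le_rfl⟩
  have lt_of_gt (j : ℕ) (hj : m < j) : rootSlope F k j < rootSlope F k k' :=
    (rootSlope_lt_rootSlope hr hkm hj hk hlt (hle j)).trans_le hkm'
  refine ⟨k', nextIndex_eq_some ⟨⟨hk'.1, fun j hj => ?_⟩, fun j hj => ?_⟩, hk'.1, hk'.2, ?_⟩
  · rcases le_or_gt j m with hjm | hjm
    exacts [hmax j ⟨hj, hjm⟩, (lt_of_gt j hjm).le]
  · by_contra! hkj
    refine (hj.2 k' hk'.1).not_gt ?_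
    rcases le_or_gt j m with hjm | hjm
    exacts [hlast j ⟨hj.1, hjm⟩ hkj, lt_of_gt j hjm]
  · intro h0
    rw [rootSlope_of_coeff_eq_zero hk'.1 hk h0, le_bot_iff] at hkm'
    exact not_lt_bot (hkm' ▸ rootSlope_lt_rootSlope hr hkm m.lt_succ_self hk hlt (hle _))

lemma exists_charSeq_eq_some (hr : 0 < r) (hm : F.coeff m ≠ 0)
    (hlt : ∀ j < m, ‖F.coeff j‖ * r ^ j < ‖F.coeff m‖ * r ^ m)
    (hle : ∀ j, ‖F.coeff j‖ * r ^ j ≤ ‖F.coeff m‖ * r ^ m) : ∃ i, charSeq F i = some m := by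
  have hF : F ≠ 0 := PowerSeries.exists_coeff_ne_zero_iff_ne_zero.1 ⟨m, hm⟩
  have hfin : {k | k ≤ m ∧ F.coeff k ≠ 0 ∧ ∃ i, charSeq F i = some k}.Finite :=
    (Set.finite_Iic m).subset fun k hk => hk.1
  obtain ⟨k, ⟨hkm, hk, i, hi⟩, hmax⟩ := hfin.exists_maximal
    ⟨F.order.toNat, not_lt.1 fun h => hm (PowerSeries.coeff_of_lt_order_toNat _ h),
      PowerSeries.coeff_order hF, 0, rfl⟩
  obtain rfl | hkm := hkm.eq_or_lt
  · exact ⟨i, hi⟩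
  obtain ⟨k', hnext, hkk', hk'm, hk'⟩ := exists_nextIndex_le hr hkm hk (hlt k hkm) hle
  exact absurd (hmax ⟨hk'm, hk', i + 1, by rw [charSeq, hi, Option.bind_some, hnext]⟩ hkk'.le)
    hkk'.not_ge

lemma IsWeierstrassDegree.neg_logb_mem_rootValuations (hr : 0 < r) (hN : IsWeierstrassDegree F r N)
    (hmN : m < N) (heq : ‖F.coeff m‖ * r ^ m = ‖F.coeff N‖ * r ^ N) :
    ((-Real.logb p r : ℝ) : EReal) ∈ rootValuations F := by
  -- The first maximal index `k` and the last one `N` are consecutive in the characteristic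
  -- sequence.
  obtain ⟨k, hkeq, hfirst⟩ : ∃ k, ‖F.coeff k‖ * r ^ k = ‖F.coeff N‖ * r ^ N ∧
      ∀ j < k, ‖F.coeff j‖ * r ^ j ≠ ‖F.coeff N‖ * r ^ N := by
    classical
    have hex : ∃ k, ‖F.coeff k‖ * r ^ k = ‖F.coeff N‖ * r ^ N := ⟨m, heq⟩
    exact ⟨Nat.find hex, Nat.find_spec hex, fun _ => Nat.find_min hex⟩
  have hkN : k < N := (not_lt.1 fun h => hfirst m h heq).trans_lt hmN
  have hk : F.coeff k ≠ 0 := by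
    intro h0
    refine (hN.term_pos hr).ne ?_
    rw [← hkeq, h0, norm_zero, zero_mul]
  obtain ⟨i, hi⟩ := exists_charSeq_eq_some hr hk
    (fun j hj => hkeq ▸ (hN.le j).lt_of_ne (hfirst j hj)) fun j => hkeq ▸ hN.le j
  have hslope : rootSlope F k N = ((-Real.logb p r : ℝ) : EReal) :=
    le_antisymm ((rootSlope_le_neg_logb_iff hr hkN hk).2 hkeq.ge)
      ((neg_logb_le_rootSlope_iff hr hkN hk).2 hkeq.le)
  have hnext : nextIndex F k = some N := by
    refine nextIndex_eq_some ⟨⟨hkN, fun j hj => ?_⟩, fun j hj => ?_⟩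
    · rw [hslope, rootSlope_le_neg_logb_iff hr hj hk, hkeq]
      exact hN.le j
    · have hNj := hj.2 N hkN
      rw [hslope, neg_logb_le_rootSlope_iff hr hj.1 hk, hkeq] at hNj
      exact not_lt.1 fun h => (hN.lt j h).not_ge hNj
  exact ⟨i, k, N, hi, by rw [charSeq, hi, Option.bind_some, hnext], hslope.symm⟩

lemma norm_term_le_norm_eval {x : ℂ_[p]} (hx : x ≠ 0) (hF : F.IsRestricted ‖x‖)
    (hval : vp x ∉ rootValuations F) (k : ℕ) : ‖F.coeff k‖ * ‖x‖ ^ k ≤ ‖eval F x‖ := by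
  have hr : 0 < ‖x‖ := norm_pos_iff.2 hx
  by_cases hF0 : F = 0
  · simp [hF0]
  obtain ⟨N, hN⟩ := exists_isWeierstrassDegree hF0 hr hF
  have hdom : ∀ i ≠ N, ‖F.coeff i * x ^ i‖ < ‖F.coeff N * x ^ N‖ := by
    intro i hi
    simp only [norm_mul, norm_pow]
    rcases hi.lt_or_gt with hi | hi
    · refine (hN.le i).lt_of_ne fun heq => hval ?_
      rw [vp_of_ne_zero hx]
      exact hN.neg_logb_mem_rootValuations hr hi heq
    · exact hN.lt i hi
  rw [eval, norm_eq_of_hasSum_of_forall_lt (hasSum_of_isRestricted hF le_rfl) hdom, norm_mul,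
    norm_pow]
  exact hN.le k

end Valuations

section Discs

variable {p : ℕ} [Fact p.Prime] {F G : PowerSeries ℂ_[p]} {D : Set ℂ_[p]} {x a : ℂ_[p]}

lemma ConvergesOn.isRestricted (hF : ConvergesOn F D) (hx : x ∈ D) : F.IsRestricted ‖x‖ := by
  rw [PowerSeries.isRestricted_iff]
  simpa only [norm_mul, norm_pow, norm_zero] using (hF x hx).tendsto_cofinite_zero.norm

lemma mem_of_balanced_of_norm_le (hD : Balanced ℂ_[p] D) {y : ℂ_[p]} (hx : x ∈ D)
    (h : ‖y‖ ≤ ‖x‖) : y ∈ D := by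
  simpa using hD.smul_mem_mono (x := (1 : ℂ_[p])) (a := x) (b := y) (by simpa using hx) h

lemma eval_zero (F : PowerSeries ℂ_[p]) : eval F 0 = F.coeff 0 := by
  rw [eval, tsum_eq_single 0 fun i hi => by simp [hi], pow_zero, mul_one]

lemma norm_eval_eq_norm_coeff_zero (hD : Balanced ℂ_[p] D) (hF : ConvergesOn F D)
    (hroot : ∀ x ∈ D, eval F x ≠ 0) (hx : x ∈ D) : ‖eval F x‖ = ‖F.coeff 0‖ := by
  by_cases hx0 : x = 0
  · rw [hx0, eval_zero]
  · exact norm_tsum_eq_norm_coeff_zero (norm_pos_iff.2 hx0) (hF.isRestricted hx)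
      (fun y hy => hroot y (mem_of_balanced_of_norm_le hD hx hy)) le_rfl

lemma exists_pos_le_norm_eval (hD : Balanced ℂ_[p] D) (ha : a ∈ D) (hF : ConvergesOn F D)
    (hroot : ∀ x ∈ D, eval F x ≠ 0) : ∃ c > 0, ∀ x ∈ D, c ≤ ‖eval F x‖ :=
  ⟨‖eval F a‖, norm_pos_iff.2 (hroot a ha), fun x hx => by
    rw [norm_eval_eq_norm_coeff_zero hD hF hroot ha, norm_eval_eq_norm_coeff_zero hD hF hroot hx]⟩

lemma exists_pos_le_norm_eval_of_lt_norm (hF0 : F ≠ 0) (hF : ConvergesOn F D) (ha : a ≠ 0) :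
    ∃ c > 0, ∀ x ∈ D, ‖a‖ < ‖x‖ → vp x ∉ rootValuations F → c ≤ ‖eval F x‖ := by
  obtain ⟨k, hk⟩ := PowerSeries.exists_coeff_ne_zero_iff_ne_zero.2 hF0
  refine ⟨‖F.coeff k‖ * ‖a‖ ^ k, by positivity, fun x hx hax hval => ?_⟩
  refine le_trans (by gcongr) (norm_term_le_norm_eval ?_ (hF.isRestricted hx) hval k)
  exact norm_pos_iff.1 ((norm_nonneg a).trans_lt hax)

lemma exists_pos_le_max_norm_eval (hF0 : F ≠ 0) (hG0 : G ≠ 0) (hD : Balanced ℂ_[p] D)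
    (hF : ConvergesOn F D) (hG : ConvergesOn G D)
    (hroot : ∀ x ∈ D, ¬(eval F x = 0 ∧ eval G x = 0)) (ha : a ∈ D) (ha0 : a ≠ 0)
    (hval : ∀ x ∈ D, ‖a‖ < ‖x‖ → vp x ∉ rootValuations F ∩ rootValuations G) :
    ∃ c > 0, ∀ x ∈ D, c ≤ max ‖eval F x‖ ‖eval G x‖ := by
  obtain ⟨c, hc, hinner⟩ := exists_pos_le_max_norm_tsum hF0 hG0 (norm_pos_iff.2 ha0)
    (hF.isRestricted ha) (hG.isRestricted ha)
    fun x hx => hroot x (mem_of_balanced_of_norm_le hD ha hx)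
  obtain ⟨cF, hcF, houterF⟩ := exists_pos_le_norm_eval_of_lt_norm hF0 hF ha0
  obtain ⟨cG, hcG, houterG⟩ := exists_pos_le_norm_eval_of_lt_norm hG0 hG ha0
  refine ⟨min c (min cF cG), by positivity, fun x hx => ?_⟩
  rcases le_or_gt ‖x‖ ‖a‖ with hxa | hax
  · exact (min_le_left _ _).trans (hinner x hxa)
  · refine (min_le_right _ _).trans ?_
    rcases not_and_or.1 (hval x hx hax) with h | h
    · exact (min_le_left _ _).trans (le_max_of_le_left (houterF x hx hax h))
    · exact (min_le_right _ _).trans (le_max_of_le_right (houterG x hx hax h))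

lemma vp_le_of_le_norm {c : ℝ} (hc : 0 < c) (hx : c ≤ ‖x‖) :
    vp x ≤ ((-Real.logb p c : ℝ) : EReal) := by
  rw [vp_of_ne_zero (norm_pos_iff.1 (hc.trans_le hx)), EReal.coe_le_coe_iff, neg_le_neg_iff]
  exact Real.logb_le_logb_of_le (one_lt_natCast_prime p) hc hx

lemma supPhi_lt_top_of_le_max {c : ℝ} (hc : 0 < c)
    (h : ∀ x ∈ D, c ≤ max ‖eval F x‖ ‖eval G x‖) : supPhi F G D < ⊤ := by
  refine lt_of_le_of_lt (iSup₂_le fun x hx => min_le_iff.2 ?_)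
    (EReal.coe_lt_top (-Real.logb p c))
  exact (le_max_iff.1 (h x hx)).imp (vp_le_of_le_norm hc) (vp_le_of_le_norm hc)

lemma exists_lt_norm_lt_one {K : Type*} [NontriviallyNormedField K] [IsAlgClosed K] {t : ℝ}
    (ht : t < 1) : ∃ x : K, t < ‖x‖ ∧ ‖x‖ < 1 := by
  obtain ⟨y, hy0, hy1⟩ := NormedField.exists_norm_lt_one K
  obtain ⟨n, hn⟩ := exists_pow_lt_of_lt_one hy0 ht
  have hn0 : n ≠ 0 := by
    rintro rfl
    exact hn.not_gt (by simpa using hy1)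
  obtain ⟨x, rfl⟩ := IsAlgClosed.exists_pow_nat_eq y hn0.bot_lt
  rw [norm_pow] at hn hy1
  exact ⟨x, lt_of_pow_lt_pow_left₀ n (norm_nonneg x) hn,
    (pow_lt_one_iff_of_nonneg (norm_nonneg x) hn0).1 hy1⟩

lemma rpow_neg_toReal_vp (hx : x ≠ 0) : (p : ℝ) ^ (-(vp x).toReal) = ‖x‖ := by
  have hp := one_lt_natCast_prime p
  rw [vp_of_ne_zero hx, EReal.toReal_coe, neg_neg,
    Real.rpow_logb (by positivity) hp.ne' (norm_pos_iff.2 hx)]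

lemma exists_mem_ball_forall_vp_notMem {I : Set EReal} (hI : I.Finite) :
    ∃ a ∈ Metric.ball (0 : ℂ_[p]) 1, a ≠ 0 ∧
      ∀ x ∈ Metric.ball (0 : ℂ_[p]) 1, ‖a‖ < ‖x‖ → vp x ∉ I := by
  have hnear : ∀ᶠ t in 𝓝[<] (1 : ℝ), ∀ α ∈ I,
      (p : ℝ) ^ (-α.toReal) < 1 → (p : ℝ) ^ (-α.toReal) < t :=
    (eventually_all_finite hI).2 fun α _ => eventually_imp_distrib_left.2 fun hα =>
      (eventually_gt_nhds hα).filter_mono nhdsWithin_le_nhds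
  have hnonneg : ∀ᶠ t in 𝓝[<] (1 : ℝ), 0 ≤ t :=
    (eventually_ge_nhds one_pos).filter_mono nhdsWithin_le_nhds
  obtain ⟨t, ⟨hIt, ht0⟩, ht⟩ := ((hnear.and hnonneg).and self_mem_nhdsWithin).exists
  obtain ⟨a, hta, ha⟩ := exists_lt_norm_lt_one (K := ℂ_[p]) ht
  refine ⟨a, by simpa using ha, norm_pos_iff.1 (ht0.trans_lt hta), fun x hx hax hmem => ?_⟩
  have hvp := rpow_neg_toReal_vp (norm_pos_iff.1 ((norm_nonneg a).trans_lt hax))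
  rw [mem_ball_zero_iff, ← hvp] at hx
  exact (hvp ▸ hIt _ hmem hx).not_gt (hta.trans hax)

end Discs

end PadicSeries

theorem proposition5p2_general (p : ℕ) [Fact p.Prime] (F G : PowerSeries ℂ_[p])
    (D : Set ℂ_[p]) (hD : Balanced ℂ_[p] D)
    (hF : PadicSeries.ConvergesOn F D) (hG : PadicSeries.ConvergesOn G D)
    (hroot : ∀ x ∈ D, ¬ (PadicSeries.eval F x = 0 ∧ PadicSeries.eval G x = 0))
    (hval : ∃ a ∈ D, a ≠ 0 ∧ ∀ x ∈ D, ‖a‖ < ‖x‖ →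
      PadicSeries.vp x ∉ PadicSeries.rootValuations F ∩ PadicSeries.rootValuations G) :
    PadicSeries.supPhi F G D < ⊤ := by
  obtain ⟨a, ha, ha0, hval⟩ := hval
  obtain ⟨c, hc, h⟩ : ∃ c > 0, ∀ x ∈ D, c ≤ max ‖PadicSeries.eval F x‖ ‖PadicSeries.eval G x‖ := by
    by_cases hF0 : F = 0
    · obtain ⟨c, hc, h⟩ := PadicSeries.exists_pos_le_norm_eval hD ha hG fun x hx hGx =>
        hroot x hx ⟨by simp [hF0, PadicSeries.eval], hGx⟩
      exact ⟨c, hc, fun x hx => le_max_of_le_right (h x hx)⟩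
    by_cases hG0 : G = 0
    · obtain ⟨c, hc, h⟩ := PadicSeries.exists_pos_le_norm_eval hD ha hF fun x hx hFx =>
        hroot x hx ⟨hFx, by simp [hG0, PadicSeries.eval]⟩
      exact ⟨c, hc, fun x hx => le_max_of_le_left (h x hx)⟩
    exact PadicSeries.exists_pos_le_max_norm_eval hF0 hG0 hD hF hG hroot ha ha0 hval
  exact PadicSeries.supPhi_lt_top_of_le_max hc h

theorem proposition5p2 (p : ℕ) [Fact p.Prime] (F G : PowerSeries ℂ_[p])
    (D : Set ℂ_[p])
    (hD : D = Metric.ball (0 : ℂ_[p]) 1 ∨ D = Metric.closedBall (0 : ℂ_[p]) 1)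
    (hF : PadicSeries.ConvergesOn F D) (hG : PadicSeries.ConvergesOn G D)
    (hroot : ∀ x ∈ D, ¬ (PadicSeries.eval F x = 0 ∧ PadicSeries.eval G x = 0))
    (hfin : (PadicSeries.rootValuations F ∩ PadicSeries.rootValuations G).Finite) :
    PadicSeries.supPhi F G D < ⊤ := by
  refine proposition5p2_general p F G D ?_ hF hG hroot ?_ <;> rcases hD with rfl | rfl
  exacts [balanced_ball_zero, balanced_closedBall_zero,
    PadicSeries.exists_mem_ball_forall_vp_notMem hfin,
    ⟨1, by simp, one_ne_zero, fun x hx h1 => absurd h1 (by simpa using hx)⟩]
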